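/- Let $\mathbb S^3=\{p=(z,w)\in\mathbb C^2: |z|^2+|w|^2=1\}$ with its canonical Riemannian metric $g$ (constant curvature $1$) and Levi-Civita connection $\nabla^g$, and let $\mathrm{SU}(2)$ act on $\mathbb S^3$ by matrix multiplication, $\tau_s(p)=s\cdot p$. For a vector field $X$ put $(\tau_s(X))_p=(\tau_s)_*(X_{s^{-1}p})$. A (smooth) affine connection $\nabla$ on $\mathbb S^3$ is $\mathrm{SU}(2)$-invariant if $\tau_s(\nabla_XY)=\nabla_{\tau_s(X)}\tau_s(Y)$ for all $s\in \mathrm{SU}(2)$ and $X,Y\in\mathfrak X(\mathbb S^3)$; it is metric if $X(g(Y,Z))=g(\nabla_XY,Z)+g(Y,\nabla_XZ)$; it has totally skew-symmetric torsion if $\omega_\nabla(X,Y,Z)=g(T^\nabla(X,Y),Z)$ is a $3$-form, where $T^\nabla(X,Y)=\nabla_XY-\nabla_YX-[X,Y]$. Identify $\mathrm{SU}(2)$ with $\mathbb S^3$ by $s\mapsto s\cdot o$, $o=(0,1)$, and let $E_1,E_2,E_3$ be the orthonormal frame of $\mathbb S^3$ formed by the left-invariant vector fields $(E_i)_{s\cdot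 o}=sE_i\,o$ given by $$E_1=\begin{pmatrix}0&1\\-1&0\end{pmatrix},\quad E_2=\begin{pmatrix}0&\mathbf i\\ \mathbf i&0\end{pmatrix},\quad E_3=\begin{pmatrix}-\mathbf i&0\\0&\mathbf i\end{pmatrix}.$$ Let $E_i^\flat=g(E_i,\cdot)$, and $\sigma^1=E_2^\flat\otimes E_3-E_3^\flat\otimes E_2$, $\sigma^2=E_3^\flat\otimes E_1-E_1^\flat\otimes E_3$, $\sigma^3=E_1^\flat\otimes E_2-E_2^\flat\otimes E_1$. Let $\xi_p=-\mathbf i p$, let $\psi(X)$ and $\eta(X)$ be defined by $\mathbf iX=\psi(X)+\eta(X)N$ with $N$ the outward unit normal and $\psi(X)$ tangent, and let $\Phi(X,Y)=g(X,\psi(Y))$. (1) An affine connection $\nabla$ on $\mathbb S^3$ is $\mathrm{SU}(2)$-invariant and metric if and only if there are $t_{ij}\in\mathbb R$, $i,j\in\{1,2,3\}$, such that $$\nabla_XY=\nabla^g_XY+\sum_{i,j=1}^3t_{ij}E_i^\flat(X)\sigma^j(Y)\qquad\text{for all }X,Y\in\mathfrak X(\mathbb S^3),$$ and for every choice of the $t_{ij}$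 this formula defines an affine connection. (2) An affine connection $\nabla$ on $\mathbb S^3$ is $\mathrm{SU}(2)$-invariant and metric with totally skew-symmetric torsion if and only if there is $r\in\mathbb R$ such that $$\nabla_XY=\nabla^g_XY+r\big(\Phi(X,Y)\xi-\eta(X)\psi(Y)+\eta(Y)\psi(X)\big)\qquad\text{for all }X,Y\in\mathfrak X(\mathbb S^3),$$ and for every $r\in\mathbb R$ this formula defines an affine connection. (3) Every connection $\nabla$ as in (2) is $\nabla$-Einstein, that is, $\mathrm{Sym}(\mathrm{Ric}^\nabla)=\frac{s^\nabla}{3}\,g$, where $\mathrm{Ric}^\nabla(Y,Z)=\mathrm{tr}(X\mapsto R^\nabla(X,Y)Z)$ with $R^\nabla(X,Y)=\nabla_X\nabla_Y-\nabla_Y\nabla_X-\nabla_{[X,Y]}$ and $s^\nabla=\mathrm{tr}_g\,\mathrm{Ric}^\nabla$; and if $r$ is its parameter in (2), then $$\mathrm{Sym}(\mathrm{Ric}^\nabla)=2(1-r^2)\,g.$$ -/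

import Mathlib

open scoped Manifold ContDiff ComplexConjugate

noncomputable section

namespace SphereThree

/-- `ℂ²` with its standard (real) Euclidean inner product `Re ⟨z, w⟩`. -/
abbrev C2 : Type := EuclideanSpace ℂ (Fin 2)

instance factFinrankC2 : Fact (Module.finrank ℝ C2 = 3 + 1) :=
  ⟨by
    rw [← Module.finrank_mul_finrank ℝ ℂ C2, Complex.finrank_real_complex,
      finrank_euclideanSpace_fin]⟩

/-- The unit sphere `S³ ⊂ ℂ²`, with the manifold structure given by stereographic projections. -/
abbrev S3 : Type := Metric.sphere (0 : C2) 1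

/-- The tangent space `T_p S³`. -/
abbrev T (p : S3) : Type := TangentSpace (𝓡 3) p

/-- The differential at `p` of the inclusion `S³ ⊂ ℂ²`. -/
def incl (p : S3) : T p →L[ℝ] C2 := mvfderiv (𝓡 3) ((↑) : S3 → C2) p

lemma incl_injective (p : S3) : Function.Injective (incl p) :=
  injective_mvfderiv_subtypeVal_sphere p

lemma range_incl (p : S3) : (incl p).range = (ℝ ∙ (p : C2))ᗮ :=
  range_mvfderiv_subtypeVal p

lemma exists_incl_eq (p : S3) (w : C2) :
    ∃ u : T p, incl p u = w - inner ℝ (p : C2) w • (p : C2) := by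
  have h : w - inner ℝ (p : C2) w • (p : C2) ∈ (incl p).range := by
    rw [range_incl, Submodule.mem_orthogonal_singleton_iff_inner_right]
    have hp : ‖(p : C2)‖ = 1 := norm_eq_of_mem_sphere p
    rw [inner_sub_right, inner_smul_right, real_inner_self_eq_norm_sq, hp]
    simp
  exact h

/-- The tangential component at `p` of an ambient vector `w ∈ ℂ²`, as an element of `T_p S³`:
the unique tangent vector whose image in `ℂ²` is `w - ⟨p, w⟩ p`. -/
def tangentPart (p : S3) (w : C2) : T p := (exists_incl_eq p w).choose

lemma incl_tangentPart (p : S3) (w : C2) :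
    incl p (tangentPart p w) = w - inner ℝ (p : C2) w • (p : C2) :=
  (exists_incl_eq p w).choose_spec

/-- The canonical Riemannian metric of `S³`, induced by the inclusion in `ℂ²`. -/
def g (p : S3) (u v : T p) : ℝ := inner ℝ (incl p u) (incl p v)

/-- Vector fields on `S³` (with no regularity). -/
abbrev VField : Type := (p : S3) → T p

/-- Smoothness of a vector field. -/
def IsSmooth (X : VField) : Prop :=
  ContMDiff (𝓡 3) (𝓡 3).tangent ∞ (fun p ↦ (⟨p, X p⟩ : TangentBundle (𝓡 3) S3))

/-! ### The action of `SU(2)` -/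

/-- The special unitary group `SU(2)`. -/
abbrev SU2 : Type := Matrix.specialUnitaryGroup (Fin 2) ℂ

lemma norm_mulVec (s : SU2) (x : C2) :
    ‖WithLp.toLp 2 ((s : Matrix (Fin 2) (Fin 2) ℂ).mulVec x)‖ = ‖x‖ := by
  have hs : star (s : Matrix (Fin 2) (Fin 2) ℂ) * (s : Matrix (Fin 2) (Fin 2) ℂ) = 1 :=
    Matrix.mem_unitaryGroup_iff'.1 (Matrix.mem_specialUnitaryGroup_iff.1 s.2).1
  have h : inner ℂ (WithLp.toLp 2 ((s : Matrix (Fin 2) (Fin 2) ℂ).mulVec x))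
      (WithLp.toLp 2 ((s : Matrix (Fin 2) (Fin 2) ℂ).mulVec x)) = inner ℂ x x := by
    rw [EuclideanSpace.inner_eq_star_dotProduct, EuclideanSpace.inner_eq_star_dotProduct]
    simp only [Matrix.star_mulVec]
    rw [dotProduct_comm, ← Matrix.dotProduct_mulVec, Matrix.mulVec_mulVec,
      ← Matrix.star_eq_conjTranspose, hs, Matrix.one_mulVec, dotProduct_comm]
  rw [inner_self_eq_norm_sq_to_K, inner_self_eq_norm_sq_to_K] at h
  have h' : ‖WithLp.toLp 2 ((s : Matrix (Fin 2) (Fin 2) ℂ).mulVec x)‖ ^ 2 = ‖x‖ ^ 2 := by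
    exact_mod_cast h
  exact (pow_left_inj₀ (norm_nonneg _) (norm_nonneg _) two_ne_zero).1 h'

/-- The left translation `τ_s : S³ → S³`, `p ↦ s · p` (matrix multiplication). -/
def tau (s : SU2) (p : S3) : S3 :=
  ⟨WithLp.toLp 2 ((s : Matrix (Fin 2) (Fin 2) ℂ).mulVec (p : C2)), by
    rw [mem_sphere_zero_iff_norm, norm_mulVec]
    exact norm_eq_of_mem_sphere p⟩

/-- The transformed vector field `τ_s(X)`, `(τ_s(X))_p = (τ_s)_* (X_{s⁻¹ · p})`. -/
def push (s : SU2) (X : VField) : VField :=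
  fun p ↦ mfderiv (𝓡 3) (𝓡 3) (tau s) (tau s⁻¹ p) (X (tau s⁻¹ p))

/-! ### Affine connections -/

/-- Affine connections on `S³`; `nabla Y p (X p)` is `(∇_X Y)_p`. -/
abbrev Connection : Type := CovariantDerivative (𝓡 3) (EuclideanSpace ℝ (Fin 3)) T

/-- The vector field `∇_X Y`. -/
def cov (nabla : Connection) (X Y : VField) : VField := fun p ↦ nabla Y p (X p)

/-- Smoothness of an affine connection: `∇Y` is smooth whenever `Y` is. -/
def IsSmoothConnection (nabla : Connection) : Prop :=
  CovariantDerivative.ContMDiffCovariantDerivative nabla ∞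

/-- `∇` is `SU(2)`-invariant: `τ_s(∇_X Y) = ∇_{τ_s(X)} τ_s(Y)`. -/
def IsInvariant (nabla : Connection) : Prop :=
  ∀ (s : SU2) (X Y : VField), IsSmooth X → IsSmooth Y →
    push s (cov nabla X Y) = cov nabla (push s X) (push s Y)

/-- `∇` is metric: `X(g(Y, Z)) = g(∇_X Y, Z) + g(Y, ∇_X Z)`. -/
def IsMetric (nabla : Connection) : Prop :=
  ∀ X Y Z : VField, IsSmooth X → IsSmooth Y → IsSmooth Z → ∀ p : S3,
    mvfderiv (𝓡 3) (fun q ↦ g q (Y q) (Z q)) p (X p) =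
      g p (cov nabla X Y p) (Z p) + g p (Y p) (cov nabla X Z p)

/-- `∇` is the Levi-Civita connection of `g`: smooth, metric and torsion-free. -/
def IsLeviCivita (nabla : Connection) : Prop :=
  IsSmoothConnection nabla ∧ IsMetric nabla ∧ nabla.torsion = 0

/-- The tensor `ω_∇(X, Y, Z) = g(T^∇(X, Y), Z)`. -/
def torsionForm (nabla : Connection) (p : S3) (u v w : T p) : ℝ := g p (nabla.torsion p u v) w

/-- `∇` has totally skew-symmetric torsion: `ω_∇` is a `3`-form. -/
def HasSkewTorsion (nabla : Connection) : Prop :=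
  ∀ (p : S3) (u v w : T p),
    torsionForm nabla p v u w = -torsionForm nabla p u v w ∧
    torsionForm nabla p u w v = -torsionForm nabla p u v w

/-- The curvature `R(X, Y)Z = ∇_X ∇_Y Z - ∇_Y ∇_X Z - ∇_{[X, Y]} Z`. -/
def curvature (nabla : Connection) (X Y Z : VField) : VField :=
  cov nabla X (cov nabla Y Z) - cov nabla Y (cov nabla X Z) -
    cov nabla (VectorField.mlieBracket (𝓡 3) X Y) Z

/-! ### The left-invariant frame -/

/-- The element `s` of `SU(2)` with `s · (0, 1) = p`. -/
def toSU2 (p : S3) : SU2 :=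
  ⟨!![conj ((p : C2) 1), (p : C2) 0; -conj ((p : C2) 0), (p : C2) 1], by
    have hp : ‖(p : C2)‖ = 1 := norm_eq_of_mem_sphere p
    have h2 := EuclideanSpace.norm_sq_eq (p : C2)
    rw [hp, Fin.sum_univ_two] at h2
    generalize (p : C2) 0 = z at *
    generalize (p : C2) 1 = w at *
    have h : z * conj z + w * conj w = 1 := by
      rw [Complex.mul_conj, Complex.mul_conj, Complex.normSq_eq_norm_sq, Complex.normSq_eq_norm_sq,
        ← Complex.ofReal_add, ← h2]
      simp
    rw [Matrix.mem_specialUnitaryGroup_iff, Matrix.mem_unitaryGroup_iff]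
    constructor
    · ext i j
      fin_cases i <;> fin_cases j <;>
        simp [Matrix.mul_apply, Fin.sum_univ_two] <;> first | ring1 | linear_combination h
    · rw [Matrix.det_fin_two_of]
      linear_combination h⟩

/-- The basis `E₁, E₂, E₃` of `𝔰𝔲(2)` (indexed by `0, 1, 2`). -/
def basisMat : Fin 3 → Matrix (Fin 2) (Fin 2) ℂ :=
  ![!![0, 1; -1, 0], !![0, Complex.I; Complex.I, 0], !![-Complex.I, 0; 0, Complex.I]]

/-- The left-invariant vector fields `E₁, E₂, E₃` on `S³`, identified with `SU(2)` by
`s ↦ s · o`, `o = (0, 1)`: at `p = s · o` the value of `E_i` is `s E_i o`. -/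
def E (i : Fin 3) : VField := fun p ↦
  tangentPart p (WithLp.toLp 2 (((toSU2 p : Matrix (Fin 2) (Fin 2) ℂ) * basisMat i).mulVec ![0, 1]))

/-- The frame `E₁, E₂, E₃` is orthonormal. -/
lemma g_E (p : S3) (i j : Fin 3) : g p (E i p) (E j p) = if i = j then 1 else 0 := by
  have hp : ‖(p : C2)‖ = 1 := norm_eq_of_mem_sphere p
  have h := EuclideanSpace.norm_sq_eq (p : C2)
  rw [hp, Fin.sum_univ_two, ← Complex.normSq_eq_norm_sq, ← Complex.normSq_eq_norm_sq,
    Complex.normSq_apply, Complex.normSq_apply] at h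
  have hin : ∀ x y : C2, inner ℝ x y = (x 0).re * (y 0).re + (x 0).im * (y 0).im +
      (x 1).re * (y 1).re + (x 1).im * (y 1).im := fun x y ↦ by
    simp [PiLp.inner_apply, Fin.sum_univ_two, Complex.inner]
    ring
  have hE : ∀ k : Fin 3, incl p (E k p) = WithLp.toLp 2
      (((toSU2 p : Matrix (Fin 2) (Fin 2) ℂ) * basisMat k).mulVec ![0, 1]) := fun k ↦ by
    have h0 : inner ℝ (p : C2) (WithLp.toLp 2
        (((toSU2 p : Matrix (Fin 2) (Fin 2) ℂ) * basisMat k).mulVec ![0, 1])) = 0 := by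
      rw [hin]
      fin_cases k <;> simp [toSU2, basisMat, Matrix.mulVec, dotProduct, Matrix.mul_apply,
        Fin.sum_univ_two] <;> ring
    rw [E, incl_tangentPart, h0, zero_smul, sub_zero]
  rw [g, hE, hE, hin]
  fin_cases i <;> fin_cases j <;> simp [toSU2, basisMat, Matrix.mulVec, dotProduct,
    Matrix.mul_apply, Fin.sum_univ_two] <;> first | ring1 | linear_combination -h

/-- The `1`-form `E_i^♭ = g(E_i, ·)`. -/
def flat (i : Fin 3) (p : S3) (v : T p) : ℝ := g p (E i p) v

/-- The `(1,1)`-tensors `σ¹ = E₂^♭ ⊗ E₃ - E₃^♭ ⊗ E₂` and its cyclic permutations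
(`Fin 3` addition is modulo `3`). -/
def sigma (j : Fin 3) (p : S3) (v : T p) : T p :=
  flat (j + 1) p v • E (j + 2) p - flat (j + 2) p v • E (j + 1) p

/-! ### The Sasakian structure -/

/-- The Hopf vector field `ξ_z = -i z`. -/
def xi : VField := fun p ↦ tangentPart p (-(Complex.I • (p : C2)))

/-- `ψ(X)` is the tangential component of `i X`. -/
def psi (p : S3) (v : T p) : T p := tangentPart p (Complex.I • incl p v)

/-- `η(X)` is the component of `i X` along the outward unit normal. -/
def eta (p : S3) (v : T p) : ℝ := inner ℝ (Complex.I • incl p v) (p : C2)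

/-- The Sasakian form `Φ(X, Y) = g(X, ψ(Y))`. -/
def Phi (p : S3) (u v : T p) : ℝ := g p u (psi p v)

/-! ### Ricci curvature and the Einstein equation -/

/-- The Ricci tensor `Ric(Y, Z) = tr(X ↦ R(X, Y)Z)`, computed in the orthonormal frame `E_i`. -/
def ricci (nabla : Connection) (Y Z : VField) (p : S3) : ℝ :=
  ∑ i : Fin 3, g p (curvature nabla (E i) Y Z p) (E i p)

/-- The symmetric part of the Ricci tensor. -/
def symRicci (nabla : Connection) (Y Z : VField) (p : S3) : ℝ :=
  (ricci nabla Y Z p + ricci nabla Z Y p) / 2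

/-- The scalar curvature. -/
def scalarCurvature (nabla : Connection) (p : S3) : ℝ :=
  ∑ j : Fin 3, ricci nabla (E j) (E j) p

/-- `(S³, g, ∇)` is `∇`-Einstein: `∇` is metric with totally skew-symmetric torsion and
`Sym(Ric^∇) = (s^∇ / dim S³) g`. -/
def IsNablaEinstein (nabla : Connection) : Prop :=
  IsMetric nabla ∧ HasSkewTorsion nabla ∧
    ∀ Y Z : VField, IsSmooth Y → IsSmooth Z → ∀ p : S3,
      symRicci nabla Y Z p = scalarCurvature nabla p / 3 * g p (Y p) (Z p)

/-! ### The two families of connections -/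

/-- `∇_X Y = ∇⁰_X Y + ∑_{i,j} t_{ij} E_i^♭(X) σ^j(Y)` for all `X, Y ∈ 𝔛(S³)`. -/
def IsMetricFamily (nabla0 : Connection) (t : Fin 3 → Fin 3 → ℝ) (nabla : Connection) : Prop :=
  ∀ X Y : VField, IsSmooth X → IsSmooth Y → ∀ p : S3,
    cov nabla X Y p = cov nabla0 X Y p +
      ∑ i : Fin 3, ∑ j : Fin 3, (t i j * flat i p (X p)) • sigma j p (Y p)

/-- `∇_X Y = ∇⁰_X Y + r (Φ(X, Y) ξ - η(X) ψ(Y) + η(Y) ψ(X))` for all `X, Y ∈ 𝔛(S³)`. -/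
def IsSkewFamily (nabla0 : Connection) (r : ℝ) (nabla : Connection) : Prop :=
  ∀ X Y : VField, IsSmooth X → IsSmooth Y → ∀ p : S3,
    cov nabla X Y p = cov nabla0 X Y p +
      r • (Phi p (X p) (Y p) • xi p - eta p (X p) • psi p (Y p) + eta p (Y p) • psi p (X p))

end SphereThree

end

noncomputable section

namespace SphereThree

open Bundle VectorField

/-! The frame `E` turns the whole problem into linear algebra on the array `Γ i j k = g(∇_{E_i} E_j,
E_k)` (`christoffel`), which determines a connection. Left translations fix every `E i` and act
transitively on the sphere, so invariance means that `Γ` is constant (`isInvariant_iff`). Since the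
frame is orthonormal, metricity means that `Γ` is skew in `j, k` (`isMetric_iff`). The quaternion
relations give `[E_i, E_j] = -2 ∑ ε_{ijk} E_k` (`flat_mlieBracket_E`), so the torsion has components
`Γ i j k - Γ j i k + 2 ε_{ijk}`, and the Levi-Civita connection is `Γ = -ε` (`isLeviCivita_iff`).

An array skew in `j, k` consists of three skew `3 × 3` matrices, hence of nine free parameters:
these are the `t_{ij}`. Skew torsion forces `Γ` to be alternating in all three indices, hence a
multiple `(r - 1) ε`, because alternating trilinear forms in dimension three form a line; the
Sasakian tensor of the second family is exactly the cross product `ε` (`isSkewFamily_iff`).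

For `Γ = a ε` the curvature is that of constant sectional curvature `-(a² + 2a)`
(`flat_curvature_of_eps`). With `a = r - 1` this number is `1 - r²`, and the Ricci tensor is `2 (1 -
r²) g`. -/

/-! ### The left-invariant frame and its smoothness -/

/-- The real-linear endomorphisms of `ℂ²` whose restrictions to `S³` are the fields `E i`. -/
def frameLin (i : Fin 3) : C2 →ₗ[ℝ] C2 where
  toFun x := WithLp.toLp 2
    ((!![conj (x 1), x 0; -conj (x 0), x 1] * basisMat i).mulVec ![0, 1])
  map_add' x y := by
    ext j
    fin_cases i <;> fin_cases j <;> simp [basisMat] <;> ring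
  map_smul' c x := by
    ext j
    fin_cases i <;> fin_cases j <;> simp [basisMat] <;> ring

lemma inner_C2 (x y : C2) : inner ℝ x y = (x 0).re * (y 0).re + (x 0).im * (y 0).im +
    (x 1).re * (y 1).re + (x 1).im * (y 1).im := by
  simp [PiLp.inner_apply, Fin.sum_univ_two, Complex.inner]
  ring

lemma frameLin_zero_apply (x : C2) : frameLin 0 x = !₂[conj (x 1), -conj (x 0)] := by
  ext j
  fin_cases j <;> simp [frameLin, basisMat]

lemma frameLin_one_apply (x : C2) :
    frameLin 1 x = !₂[Complex.I * conj (x 1), -(Complex.I * conj (x 0))] := by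
  ext j
  fin_cases j <;> simp [frameLin, basisMat] <;> ring

lemma frameLin_two_apply (x : C2) : frameLin 2 x = !₂[Complex.I * x 0, Complex.I * x 1] := by
  ext j
  fin_cases j <;> simp [frameLin, basisMat] <;> ring

lemma inner_frameLin_self (i : Fin 3) (x : C2) : inner ℝ x (frameLin i x) = 0 := by
  rw [inner_C2]
  fin_cases i <;>
    simp [frameLin_zero_apply, frameLin_one_apply, frameLin_two_apply] <;> ring

lemma norm_frameLin (i : Fin 3) (x : C2) : ‖frameLin i x‖ = ‖x‖ := by
  rw [← sq_eq_sq₀ (norm_nonneg _) (norm_nonneg _), ← real_inner_self_eq_norm_sq,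
    ← real_inner_self_eq_norm_sq, inner_C2, inner_C2]
  fin_cases i <;>
    simp [frameLin_zero_apply, frameLin_one_apply, frameLin_two_apply] <;> ring

lemma incl_E (i : Fin 3) (p : S3) : incl p (E i p) = frameLin i p := by
  have h : incl p (E i p) = frameLin i p - inner ℝ (p : C2) (frameLin i p) • (p : C2) :=
    incl_tangentPart p _
  rw [h, inner_frameLin_self, zero_smul, sub_zero]

lemma contMDiff_frameLin (i : Fin 3) :
    ContMDiff 𝓘(ℝ, C2) 𝓘(ℝ, C2) ∞ (frameLin i) :=
  (LinearMap.toContinuousLinearMap (frameLin i)).contDiff.contMDiff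

/-- The flow of the vector field `E i`. -/
def flow (i : Fin 3) (q : ℝ × S3) : S3 :=
  ⟨Real.cos q.1 • (q.2 : C2) + Real.sin q.1 • frameLin i q.2, by
    have hp : ‖(q.2 : C2)‖ = 1 := norm_eq_of_mem_sphere q.2
    rw [mem_sphere_zero_iff_norm, ← sq_eq_sq₀ (norm_nonneg _) zero_le_one, norm_add_sq_real,
      inner_smul_left, inner_smul_right, inner_frameLin_self, norm_smul, norm_smul,
      norm_frameLin, hp]
    simp⟩

lemma contMDiff_coe : ContMDiff (𝓡 3) 𝓘(ℝ, C2) ∞ ((↑) : S3 → C2) := contMDiff_coe_sphere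

lemma contMDiff_flow (i : Fin 3) :
    ContMDiff (𝓘(ℝ, ℝ).prod (𝓡 3)) (𝓡 3) ∞ (flow i) := by
  refine ContMDiff.codRestrict_sphere (f := fun q : ℝ × S3 ↦
    Real.cos q.1 • (q.2 : C2) + Real.sin q.1 • frameLin i q.2) ?_ _
  have h1 : ContMDiff (𝓘(ℝ, ℝ).prod (𝓡 3)) 𝓘(ℝ, C2) ∞ (fun q : ℝ × S3 ↦ (q.2 : C2)) :=
    contMDiff_coe.comp contMDiff_snd
  have hc : ContMDiff (𝓘(ℝ, ℝ).prod (𝓡 3)) 𝓘(ℝ, ℝ) ∞ (fun q : ℝ × S3 ↦ Real.cos q.1) :=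
    Real.contDiff_cos.contMDiff.comp contMDiff_fst
  have hs : ContMDiff (𝓘(ℝ, ℝ).prod (𝓡 3)) 𝓘(ℝ, ℝ) ∞ (fun q : ℝ × S3 ↦ Real.sin q.1) :=
    Real.contDiff_sin.contMDiff.comp contMDiff_fst
  exact (hc.smul h1).add (hs.smul ((contMDiff_frameLin i).comp h1))

lemma flow_zero (i : Fin 3) (p : S3) : flow i (0, p) = p := by
  ext1; simp [flow]

lemma mfderiv_flow (i : Fin 3) (p : S3) :
    (mfderiv 𝓘(ℝ, ℝ) (𝓡 3) (fun s : ℝ ↦ flow i (s, p)) 0 (1 : ℝ) : EuclideanSpace ℝ (Fin 3)) =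
      E i p := by
  have h1 : MDifferentiableAt 𝓘(ℝ, ℝ) (𝓡 3) (fun s : ℝ ↦ flow i (s, p)) 0 :=
    ((contMDiff_flow i).comp (contMDiff_id.prodMk contMDiff_const)).mdifferentiableAt (by simp)
  have h2 : MDifferentiableAt (𝓡 3) 𝓘(ℝ, C2) ((↑) : S3 → C2) p :=
    contMDiff_coe.mdifferentiableAt (by simp)
  have h3 := mfderiv_comp_apply_of_eq (I := 𝓘(ℝ, ℝ)) (I' := 𝓡 3) (I'' := 𝓘(ℝ, C2))
    (f := fun s : ℝ ↦ flow i (s, p)) (g := ((↑) : S3 → C2)) (0 : ℝ) h2 h1 (flow_zero i p) (1 : ℝ)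
  have h4 : HasDerivAt (fun s : ℝ ↦ Real.cos s • (p : C2) + Real.sin s • frameLin i p)
      (- Real.sin 0 • (p : C2) + Real.cos 0 • frameLin i p) 0 :=
    ((Real.hasDerivAt_cos 0).smul_const _).add ((Real.hasDerivAt_sin 0).smul_const _)
  have h5 : mfderiv 𝓘(ℝ, ℝ) 𝓘(ℝ, C2) (((↑) : S3 → C2) ∘ fun s : ℝ ↦ flow i (s, p)) 0 =
    fderiv ℝ (fun s : ℝ ↦ Real.cos s • (p : C2) + Real.sin s • frameLin i p) 0 :=
    mfderiv_eq_fderiv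
  apply incl_injective p
  refine h3.symm.trans ?_
  rw [h5, incl_E]
  refine h4.deriv.trans ?_
  simp

lemma isSmooth_E (i : Fin 3) : IsSmooth (E i) := by
  -- `E i` is the image of the smooth section `p ↦ (∂_t at 0, zero vector at p)` under the tangent
  -- map of `flow i`, so joint smoothness of the flow suffices.
  let F₁ : S3 → TangentBundle 𝓘(ℝ, ℝ) ℝ × TangentBundle (𝓡 3) S3 :=
    fun p ↦ (⟨0, (1 : ℝ)⟩, TotalSpace.mk' (EuclideanSpace ℝ (Fin 3)) p 0)
  have S₁ : ContMDiff (𝓡 3) (𝓘(ℝ, ℝ).tangent.prod (𝓡 3).tangent) ∞ F₁ :=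
    contMDiff_const.prodMk (contMDiff_zeroSection _ _)
  have S₂ := (contMDiff_equivTangentBundleProd_symm (I := 𝓘(ℝ, ℝ)) (M := ℝ) (I' := 𝓡 3)
    (M' := S3) (n := ∞)).comp S₁
  have S₃ := ((contMDiff_flow i).contMDiff_tangentMap (m := ∞) (by simp)).comp S₂
  unfold IsSmooth
  convert! S₃ with p
  · simp [F₁, tangentMap, flow_zero]
  · simp only [Function.comp_apply, tangentMap, F₁]
    rw [mfderiv_prod_eq_add_apply]
    · refine ((mfderiv_flow i p).symm.trans ?_)
      exact (add_zero _).symm.trans (congrArg _ (map_zero _).symm)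
    · exact (contMDiff_flow i).mdifferentiableAt (by simp)

/-! ### Components of vector fields in the frame -/

lemma contMDiffAt_incl {n : ℕ∞} {X : VField} {p : S3}
    (hX : ContMDiffAt (𝓡 3) (𝓡 3).tangent n
      (fun p ↦ (⟨p, X p⟩ : TangentBundle (𝓡 3) S3)) p) :
    ContMDiffAt (𝓡 3) 𝓘(ℝ, C2) n (fun p ↦ incl p (X p)) p := by
  have h := (contMDiff_coe_sphere (m := n + 1) (E := C2) (n := 3)).contMDiff_tangentMap (m := n) le_rfl
  exact (contMDiff_snd_tangentBundle_modelSpace C2 𝓘(ℝ, C2)).contMDiffAt.comp p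
    (h.contMDiffAt.comp p hX)

lemma mdifferentiableAt_incl {X : VField} {p : S3}
    (hX : MDifferentiableAt (𝓡 3) (𝓡 3).tangent
      (fun p ↦ (⟨p, X p⟩ : TangentBundle (𝓡 3) S3)) p) :
    MDifferentiableAt (𝓡 3) 𝓘(ℝ, C2) (fun p ↦ incl p (X p)) p := by
  have h := (contMDiff_coe_sphere (m := 2) (E := C2) (n := 3)).contMDiff_tangentMap (m := 1)
    (by norm_num)
  exact ((contMDiff_snd_tangentBundle_modelSpace C2 𝓘(ℝ, C2) (n := 1)).mdifferentiable
    one_ne_zero _).comp p ((h.mdifferentiable one_ne_zero _).comp p hX)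

lemma flat_eq (i : Fin 3) (p : S3) (v : T p) :
    flat i p v = innerSL ℝ (frameLin i p) (incl p v) := by
  rw [flat, g, incl_E]; rfl

lemma contMDiffAt_flat {n : ℕ∞} {X : VField} {p : S3} (i : Fin 3)
    (hX : ContMDiffAt (𝓡 3) (𝓡 3).tangent n
      (fun p ↦ (⟨p, X p⟩ : TangentBundle (𝓡 3) S3)) p) :
    ContMDiffAt (𝓡 3) 𝓘(ℝ, ℝ) n (fun p ↦ flat i p (X p)) p := by
  simp only [flat_eq]
  have h1 : ContMDiffAt (𝓡 3) 𝓘(ℝ, C2) n (fun p : S3 ↦ frameLin i p) p :=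
    (((contMDiff_frameLin i).comp contMDiff_coe).contMDiffAt).of_le (mod_cast le_top)
  exact ((innerSL ℝ (E := C2)).contDiff.contMDiff.contMDiffAt.comp p h1).clm_apply
    (contMDiffAt_incl hX)

lemma mdifferentiableAt_flat {X : VField} {p : S3} (i : Fin 3)
    (hX : MDifferentiableAt (𝓡 3) (𝓡 3).tangent
      (fun p ↦ (⟨p, X p⟩ : TangentBundle (𝓡 3) S3)) p) :
    MDifferentiableAt (𝓡 3) 𝓘(ℝ, ℝ) (fun p ↦ flat i p (X p)) p := by
  simp only [flat_eq]
  have h1 : ContMDiffAt (𝓡 3) 𝓘(ℝ, C2) 1 (fun p : S3 ↦ frameLin i p) p :=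
    (((contMDiff_frameLin i).comp contMDiff_coe).contMDiffAt).of_le (mod_cast le_top)
  exact (((innerSL ℝ (E := C2)).contDiff.contMDiff.contMDiffAt.comp p h1).mdifferentiableAt
    one_ne_zero).clm_apply
    (mdifferentiableAt_incl hX)

/-- The `1`-form `E_i^♭` as a continuous linear form. -/
def flatL (i : Fin 3) (p : S3) : T p →L[ℝ] ℝ := innerSL ℝ (frameLin i p) ∘L incl p

lemma flatL_apply (i : Fin 3) (p : S3) (v : T p) : flatL i p v = flat i p v :=
  (flat_eq i p v).symm

lemma flat_add (i : Fin 3) (p : S3) (u v : T p) : flat i p (u + v) = flat i p u + flat i p v := by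
  simp only [← flatL_apply, map_add]

lemma flat_sub (i : Fin 3) (p : S3) (u v : T p) : flat i p (u - v) = flat i p u - flat i p v := by
  simp only [← flatL_apply, map_sub]

lemma flat_zero (i : Fin 3) (p : S3) : flat i p 0 = 0 := by
  simp only [← flatL_apply, map_zero]

lemma flat_smul (i : Fin 3) (p : S3) (c : ℝ) (v : T p) : flat i p (c • v) = c * flat i p v := by
  simp only [← flatL_apply, map_smul, smul_eq_mul]

lemma flat_sum {ι : Type*} (s : Finset ι) (i : Fin 3) (p : S3) (v : ι → T p) :
    flat i p (∑ a ∈ s, v a) = ∑ a ∈ s, flat i p (v a) := by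
  simp only [← flatL_apply, map_sum]

lemma flat_E (i j : Fin 3) (p : S3) : flat i p (E j p) = if i = j then 1 else 0 := g_E p i j

lemma linearIndependent_E (p : S3) : LinearIndependent ℝ (fun i ↦ E i p) := by
  rw [Fintype.linearIndependent_iff]
  intro c hc i
  have h := congrArg (flat i p) hc
  simpa [flat_sum, flat_smul, flat_E, flat_zero] using h

lemma finrank_T (p : S3) : Module.finrank ℝ (T p) = 3 := finrank_euclideanSpace_fin

/-- The frame `E₁, E₂, E₃` as a basis of `T_p S³`. -/
def frameBasis (p : S3) : Module.Basis (Fin 3) ℝ (T p) :=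
  basisOfLinearIndependentOfCardEqFinrank (linearIndependent_E p)
    (by rw [finrank_T, Fintype.card_fin])

lemma frameBasis_apply (p : S3) (i : Fin 3) : frameBasis p i = E i p := by
  rw [frameBasis, coe_basisOfLinearIndependentOfCardEqFinrank]

lemma sum_flat_smul_E (p : S3) (v : T p) : ∑ i, flat i p v • E i p = v := by
  have h := (frameBasis p).sum_repr v
  simp only [frameBasis_apply] at h
  have hc (j : Fin 3) : flat j p v = (frameBasis p).repr v j := by
    conv_lhs => rw [← h]
    simp [flat_sum, flat_smul, flat_E]
  simpa only [hc] using h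

lemma ext_flat {p : S3} {u v : T p} (h : ∀ i, flat i p u = flat i p v) : u = v := by
  rw [← sum_flat_smul_E p u, ← sum_flat_smul_E p v]
  simp only [h]

lemma g_eq_sum (p : S3) (u v : T p) : g p u v = ∑ i, flat i p u * flat i p v := by
  conv_lhs => rw [← sum_flat_smul_E p u]
  simp only [g, map_sum, map_smul, sum_inner, real_inner_smul_left]
  rfl

lemma mdifferentiableAt_of_isSmooth {X : VField} (hX : IsSmooth X) (p : S3) :
    MDifferentiableAt (𝓡 3) (𝓡 3).tangent (fun p ↦ (⟨p, X p⟩ : TangentBundle (𝓡 3) S3)) p :=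
  hX.mdifferentiableAt (by simp)

lemma contMDiff_flat {X : VField} (i : Fin 3) (hX : IsSmooth X) :
    ContMDiff (𝓡 3) 𝓘(ℝ, ℝ) ∞ (fun p ↦ flat i p (X p)) :=
  fun p ↦ contMDiffAt_flat i (hX p)

lemma isSmooth_of_flat {X : VField}
    (h : ∀ i, ContMDiff (𝓡 3) 𝓘(ℝ, ℝ) ∞ (fun p ↦ flat i p (X p))) : IsSmooth X := by
  have hX : X = fun p ↦ ∑ i, flat i p (X p) • E i p := funext fun p ↦ (sum_flat_smul_E p _).symm
  rw [hX]
  exact ContMDiff.sum_section fun i _ ↦ (h i).smul_section (isSmooth_E i)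

/-! ### Lie brackets -/

lemma contMDiff_mvfderiv_apply {f : S3 → ℝ} {X : VField} (hf : ContMDiff (𝓡 3) 𝓘(ℝ, ℝ) ∞ f)
    (hX : IsSmooth X) : ContMDiff (𝓡 3) 𝓘(ℝ, ℝ) ∞ (fun p ↦ mvfderiv (𝓡 3) f p (X p)) :=
  (contMDiff_snd_tangentBundle_modelSpace ℝ 𝓘(ℝ, ℝ)).comp
    ((hf.contMDiff_tangentMap (m := ∞) (by simp)).comp hX)

/-- The formula `[X, Y] f = X(Y f) - Y(X f)` is extracted from the Jacobi identity for `X`, `Y` and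
`f • E 0`. After the Leibniz rule, the terms without second derivatives of `f` cancel by symmetry in
`X, Y` and by the Jacobi identity for `X`, `Y`, `E 0`; the coefficient of the nowhere zero field `E
0` is the claim. -/
lemma mvfderiv_mlieBracket {f : S3 → ℝ} {X Y : VField} (hf : ContMDiff (𝓡 3) 𝓘(ℝ, ℝ) ∞ f)
    (hX : IsSmooth X) (hY : IsSmooth Y) (p : S3) :
    mvfderiv (𝓡 3) f p (mlieBracket (𝓡 3) X Y p) =
      mvfderiv (𝓡 3) (fun q ↦ mvfderiv (𝓡 3) f q (Y q)) p (X p) -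
        mvfderiv (𝓡 3) (fun q ↦ mvfderiv (𝓡 3) f q (X q)) p (Y p) := by
  have hZ := isSmooth_E 0
  have hfZ : IsSmooth (f • E 0) := hf.smul_section hZ
  have hle : minSmoothness ℝ 2 ≤ ∞ := by
    rw [minSmoothness_of_isRCLikeNormedField]; exact WithTop.coe_le_coe.2 (le_top : (2 : ℕ∞) ≤ ⊤)
  have J := leibniz_identity_mlieBracket_apply (I := 𝓡 3) ((hX p).of_le hle) ((hY p).of_le hle)
    ((hfZ p).of_le hle)
  have J0 := leibniz_identity_mlieBracket_apply (I := 𝓡 3) ((hX p).of_le hle) ((hY p).of_le hle)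
    ((hZ p).of_le hle)
  have hsm {U V : VField} (hU : IsSmooth U) (hV : IsSmooth V) : IsSmooth (mlieBracket (𝓡 3) U V) :=
    ContDiff.mlieBracket_vectorField (m := ⊤) (n := ⊤) hU hV
      (by rw [minSmoothness_of_isRCLikeNormedField]; simp)
  have key {U : VField} : mlieBracket (𝓡 3) U (f • E 0) =
      (fun q ↦ mvfderiv (𝓡 3) f q (U q)) • E 0 + f • mlieBracket (𝓡 3) U (E 0) := by
    ext1 q
    exact mlieBracket_smul_right (hf.mdifferentiableAt (by simp))
      (mdifferentiableAt_of_isSmooth hZ q)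
  have key2 {U V : VField} (hU : IsSmooth U) (hV : IsSmooth V) :
      mlieBracket (𝓡 3) U (mlieBracket (𝓡 3) V (f • E 0)) p =
      mvfderiv (𝓡 3) (fun q ↦ mvfderiv (𝓡 3) f q (V q)) p (U p) • E 0 p +
      mvfderiv (𝓡 3) f p (V p) • mlieBracket (𝓡 3) U (E 0) p +
      mvfderiv (𝓡 3) f p (U p) • mlieBracket (𝓡 3) V (E 0) p +
      f p • mlieBracket (𝓡 3) U (mlieBracket (𝓡 3) V (E 0)) p := by
    have h1 := contMDiff_mvfderiv_apply hf hV
    rw [key, mlieBracket_add_right (mdifferentiableAt_of_isSmooth (h1.smul_section hZ) p)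
      (mdifferentiableAt_of_isSmooth (hf.smul_section (hsm hV hZ)) p),
      mlieBracket_smul_right (h1.mdifferentiableAt (by simp)) (mdifferentiableAt_of_isSmooth hZ p),
      mlieBracket_smul_right (hf.mdifferentiableAt (by simp))
        (mdifferentiableAt_of_isSmooth (hsm hV hZ) p)]
    module
  rw [key2 hX hY, key2 hY hX, key, J0] at J
  have J1 := congrArg (flat 0 p) J
  simp only [Pi.add_apply, Pi.smul_apply', flat_add, flat_smul, flat_E, if_true] at J1
  linarith

/-- The structure constants `ε_{ijk}` of the cross product. -/
def eps (i j k : Fin 3) : ℝ :=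
  if j = i + 1 ∧ k = i + 2 then 1 else if j = i + 2 ∧ k = i + 1 then -1 else 0

lemma mvfderiv_inner_linear (w : C2) (A : C2 →ₗ[ℝ] C2) (p : S3) (v : T p) :
    mvfderiv (𝓡 3) (fun q : S3 ↦ (inner ℝ w (A q) : ℝ)) p v = inner ℝ w (A (incl p v)) := by
  let L : C2 →L[ℝ] ℝ := innerSL ℝ w ∘L LinearMap.toContinuousLinearMap A
  have h2 : MDifferentiableAt (𝓡 3) 𝓘(ℝ, C2) ((↑) : S3 → C2) p :=
    contMDiff_coe.mdifferentiableAt (by simp)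
  have h := mfderiv_comp_apply (I := 𝓡 3) (I' := 𝓘(ℝ, C2)) (I'' := 𝓘(ℝ, ℝ))
    (f := ((↑) : S3 → C2)) (g := L) p L.mdifferentiableAt h2 v
  refine h.trans ?_
  rw [ContinuousLinearMap.mfderiv_eq]
  rfl

lemma flat_mlieBracket_E (i j k : Fin 3) (p : S3) :
    flat k p (mlieBracket (𝓡 3) (E i) (E j) p) = -2 * eps i j k := by
  -- The differential of this linear function at `p` is `E_k^♭`. Its derivatives along the frame are
  -- again linear functions, so the bracket becomes a commutator of the matrices `frameLin`.
  let f : S3 → ℝ := fun q ↦ inner ℝ (frameLin k p) (LinearMap.id (R := ℝ) (q : C2))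
  have hf : ContMDiff (𝓡 3) 𝓘(ℝ, ℝ) ∞ f :=
    (innerSL ℝ (frameLin k (p : C2))).contDiff.contMDiff.comp contMDiff_coe
  have h := mvfderiv_mlieBracket hf (isSmooth_E i) (isSmooth_E j) p
  simp only [f, mvfderiv_inner_linear] at h
  simp only [LinearMap.id_apply, incl_E, mvfderiv_inner_linear] at h
  rw [flat_eq, innerSL_apply_apply, h]
  have hp : ‖(p : C2)‖ = 1 := norm_eq_of_mem_sphere p
  have h1 : inner ℝ (p : C2) (p : C2) = (1 : ℝ) := by rw [real_inner_self_eq_norm_sq, hp]; norm_num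
  rw [inner_C2] at h1
  rw [inner_C2, inner_C2]
  fin_cases i <;> fin_cases j <;> fin_cases k <;>
    simp [frameLin_zero_apply, frameLin_one_apply, frameLin_two_apply, eps] <;> linarith

/-! ### Christoffel symbols -/

/-- The Christoffel symbols `g(∇_{E_i} E_j, E_k)` of a connection. -/
def christoffel (nabla : Connection) (p : S3) (i j k : Fin 3) : ℝ :=
  flat k p (cov nabla (E i) (E j) p)

lemma mvfderiv_flat_E (k j : Fin 3) (p : S3) :
    mvfderiv (𝓡 3) (fun q ↦ flat k q (E j q)) p = 0 := by
  simp only [flat_E]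
  exact mvfderiv_const _

/-- Expanding `Y = ∑ y_j E_j` and applying the Leibniz rule shows that the Christoffel symbols
determine the connection. -/
lemma flat_connection_apply (nabla : Connection) {Y : VField} {p : S3}
    (hY : MDifferentiableAt (𝓡 3) (𝓡 3).tangent
      (fun p ↦ (⟨p, Y p⟩ : TangentBundle (𝓡 3) S3)) p) (v : T p) (k : Fin 3) :
    flat k p (nabla Y p v) = mvfderiv (𝓡 3) (fun q ↦ flat k q (Y q)) p v +
      ∑ i, ∑ j, christoffel nabla p i j k * flat i p v * flat j p (Y p) := by
  have hc := nabla.isCovariantDerivativeOnUniv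
  let y (j : Fin 3) : S3 → ℝ := fun q ↦ flat j q (Y q)
  have hy (j) : MDifferentiableAt (𝓡 3) 𝓘(ℝ, ℝ) (y j) p := mdifferentiableAt_flat j hY
  have hE (j) := mdifferentiableAt_of_isSmooth (isSmooth_E j) p
  have hyE (j) := (hy j).smul_section (hE j)
  have hYs : Y = y 0 • E 0 + y 1 • E 1 + y 2 • E 2 := by
    ext1 q
    have := sum_flat_smul_E q (Y q)
    rw [Fin.sum_univ_three] at this
    exact this.symm
  have hcov (j : Fin 3) : flat k p (nabla (y j • E j) p v) =
      y j p * ∑ i, flat i p v * christoffel nabla p i j k +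
        mvfderiv (𝓡 3) (y j) p v * if k = j then 1 else 0 := by
    rw [hc.leibniz (hE j) (hy j)]
    simp only [add_apply, smul_apply,
      ContinuousLinearMap.smulRight_apply, flat_add, flat_smul, flat_E]
    congr 2
    conv_lhs => rw [← sum_flat_smul_E p v]
    simp only [map_sum, map_smul, flat_sum, flat_smul]
    rfl
  conv_lhs => rw [hYs]
  rw [hc.add (mdifferentiableAt_add_section (hyE 0) (hyE 1)) (hyE 2), hc.add (hyE 0) (hyE 1)]
  simp only [add_apply, flat_add, hcov]
  fin_cases k <;> simp [Fin.sum_univ_three, y] <;> ring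

lemma flat_cov (nabla : Connection) (X : VField) {Y : VField} (hY : IsSmooth Y) (p : S3)
    (k : Fin 3) : flat k p (cov nabla X Y p) = mvfderiv (𝓡 3) (fun q ↦ flat k q (Y q)) p (X p) +
      ∑ i, ∑ j, christoffel nabla p i j k * flat i p (X p) * flat j p (Y p) :=
  flat_connection_apply nabla (mdifferentiableAt_of_isSmooth hY p) _ _

lemma isSmooth_cov {nabla : Connection} (h : IsSmoothConnection nabla) {X Y : VField}
    (hX : IsSmooth X) (hY : IsSmooth Y) : IsSmooth (cov nabla X Y) := by
  have h1 := h.contMDiff.contMDiff (σ := Y) (by simpa using! hY.contMDiffOn)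
  exact (contMDiffOn_univ.1 h1).clm_bundle_apply hX

/-! ### Smoothness and existence of connections with constant Christoffel symbols -/

lemma contMDiff_flatL_smulRight (i : Fin 3) {V : VField} (hV : IsSmooth V) :
    ContMDiff (𝓡 3) ((𝓡 3).prod 𝓘(ℝ, EuclideanSpace ℝ (Fin 3) →L[ℝ] EuclideanSpace ℝ (Fin 3))) ∞
      (fun p ↦ (⟨p, (flatL i p).smulRight (V p)⟩ : TotalSpace
        (EuclideanSpace ℝ (Fin 3) →L[ℝ] EuclideanSpace ℝ (Fin 3)) fun p : S3 ↦ T p →L[ℝ] T p)) := by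
  intro p₀
  rw [contMDiffAt_hom_bundle]
  refine ⟨contMDiffAt_id, ?_⟩
  -- In the trivialization at `p₀` the section is `smulRight` of a coordinate form and a coordinate
  -- vector. The form is the inner product with `frameLin i p` composed with the differential of the
  -- inclusion, hence smooth.
  have h1 : ContMDiffAt (𝓡 3) 𝓘(ℝ, C2 →L[ℝ] ℝ) ∞ (fun p : S3 ↦ innerSL ℝ (frameLin i p)) p₀ :=
    (innerSL ℝ (E := C2)).contDiff.contMDiff.contMDiffAt.comp p₀
      ((contMDiff_frameLin i).comp contMDiff_coe).contMDiffAt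
  have h2 := (contMDiff_coe.contMDiffAt (x := p₀)).mfderiv_const (m := ∞) (by simp)
  have h3 := (contMDiffAt_section _).1 (hV p₀)
  have h4 := (isBoundedBilinearMap_smulRight (𝕜 := ℝ) (E := EuclideanSpace ℝ (Fin 3))
    (F := EuclideanSpace ℝ (Fin 3))).contDiff.contMDiff.contMDiffAt.comp p₀
      ((h1.clm_comp h2).prodMk_space h3)
  refine h4.congr_of_eventuallyEq ?_
  filter_upwards [(trivializationAt (EuclideanSpace ℝ (Fin 3)) (TangentSpace (𝓡 3))
    p₀).open_baseSet.mem_nhds (mem_baseSet_trivializationAt _ _ p₀)] with p hp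
  ext1 v
  simp only [ContinuousLinearMap.inCoordinates, inTangentCoordinates, flatL, incl]
  simp
  exact congrArg₂ (· • ·) rfl (congrFun (Trivialization.coe_linearMapAt_of_mem _ hp) (V p))

/-- Holds because `∇Y = ∑ E_i^♭ ⊗ ∇_{E_i} Y`. -/
lemma isSmoothConnection_of_cov_E (nabla : Connection)
    (h : ∀ Y, IsSmooth Y → ∀ i, IsSmooth (cov nabla (E i) Y)) : IsSmoothConnection nabla := by
  refine ⟨⟨fun {Y} hY ↦ ?_⟩⟩
  have hY' : IsSmooth Y := by simpa using! contMDiffOn_univ.1 hY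
  have hsum (p : S3) : nabla Y p = ∑ i, (flatL i p).smulRight (cov nabla (E i) Y p) := by
    ext1 v
    conv_lhs => rw [← sum_flat_smul_E p v]
    simp only [map_sum, map_smul, sum_apply,
      ContinuousLinearMap.smulRight_apply, flatL_apply]
    rfl
  refine contMDiffOn_univ.2 ?_
  simp only [hsum]
  exact ContMDiff.sum_section fun i _ ↦ contMDiff_flatL_smulRight i (h Y hY' i)

/-- The covariant derivative with constant Christoffel symbols `A i j k` in the frame
`E₁, E₂, E₃`. -/
def constCov (A : Fin 3 → Fin 3 → Fin 3 → ℝ) (Y : VField) (p : S3) : T p →L[ℝ] T p :=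
  ∑ k, (mvfderiv (𝓡 3) (fun q ↦ flat k q (Y q)) p +
    ∑ i, ∑ j, (A i j k * flat j p (Y p)) • flatL i p).smulRight (E k p)

lemma flat_constCov (A : Fin 3 → Fin 3 → Fin 3 → ℝ) (Y : VField) (p : S3) (v : T p) (k : Fin 3) :
    flat k p (constCov A Y p v) = mvfderiv (𝓡 3) (fun q ↦ flat k q (Y q)) p v +
      ∑ i, ∑ j, A i j k * flat j p (Y p) * flat i p v := by
  rw [constCov, sum_apply, flat_sum, Finset.sum_eq_single k]
  · rw [ContinuousLinearMap.smulRight_apply, flat_smul, flat_E, if_pos rfl, mul_one]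
    simp only [add_apply, sum_apply, smul_apply, flatL_apply, smul_eq_mul]
  · intro b _ hb
    rw [ContinuousLinearMap.smulRight_apply, flat_smul, flat_E, if_neg hb.symm, mul_zero]
  · simp

/-- The connection with constant Christoffel symbols `A i j k` in the frame `E₁, E₂, E₃`. -/
def constConnection (A : Fin 3 → Fin 3 → Fin 3 → ℝ) : Connection where
  toFun := constCov A
  isCovariantDerivativeOnUniv := by
    constructor
    · intro Y Z p hY hZ _
      ext1 v
      refine ext_flat fun k ↦ ?_
      have h : mvfderiv (𝓡 3) (fun q ↦ flat k q ((Y + Z) q)) p =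
          mvfderiv (𝓡 3) (fun q ↦ flat k q (Y q)) p +
            mvfderiv (𝓡 3) (fun q ↦ flat k q (Z q)) p := by
        simp only [Pi.add_apply, flat_add]
        exact mvfderiv_add (mdifferentiableAt_flat k hY) (mdifferentiableAt_flat k hZ)
      rw [add_apply, flat_add, flat_constCov, flat_constCov, flat_constCov, h, add_apply]
      simp only [Pi.add_apply, flat_add, mul_add, add_mul, Finset.sum_add_distrib]
      ring
    · intro Y f p hY hf _
      ext1 v
      refine ext_flat fun k ↦ ?_
      have h : mvfderiv (𝓡 3) (fun q ↦ flat k q ((f • Y) q)) p v =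
          f p * mvfderiv (𝓡 3) (fun q ↦ flat k q (Y q)) p v +
            mvfderiv (𝓡 3) f p v * flat k p (Y p) := by
        simp only [Pi.smul_apply', flat_smul]
        refine (congrArg (fun l : T p →L[ℝ] ℝ ↦ l v)
          (mvfderiv_mul hf (mdifferentiableAt_flat k hY))).trans ?_
        simp only [add_apply, smul_apply, smul_eq_mul]
        ring
      rw [add_apply, flat_add, flat_constCov, h, smul_apply, flat_smul, flat_constCov,
        ContinuousLinearMap.smulRight_apply, flat_smul]
      simp only [Pi.smul_apply', flat_smul, mul_add, Finset.mul_sum]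
      have (i j : Fin 3) : A i j k * (f p * flat j p (Y p)) * flat i p v =
        f p * (A i j k * flat j p (Y p) * flat i p v) := by ring
      simp only [this]
      ring

lemma christoffel_constConnection (A : Fin 3 → Fin 3 → Fin 3 → ℝ) (p : S3) :
    christoffel (constConnection A) p = A := by
  ext i j k
  refine (flat_constCov A (E j) p (E i p) k).trans ?_
  rw [mvfderiv_flat_E]
  simp [flat_E]

lemma isSmoothConnection_of_christoffel {nabla : Connection} {A : Fin 3 → Fin 3 → Fin 3 → ℝ}
    (h : ∀ p, christoffel nabla p = A) : IsSmoothConnection nabla := by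
  refine isSmoothConnection_of_cov_E _ fun Y hY i ↦ isSmooth_of_flat fun k ↦ ?_
  simp only [flat_cov _ _ hY, h]
  refine (contMDiff_mvfderiv_apply (contMDiff_flat k hY) (isSmooth_E i)).add ?_
  simp only [flat_E]
  exact ContMDiff.sum fun a _ ↦ ContMDiff.sum fun b _ ↦ contMDiff_const.mul (contMDiff_flat b hY)

lemma smooth_constConnection (A : Fin 3 → Fin 3 → Fin 3 → ℝ) :
    IsSmoothConnection (constConnection A) :=
  isSmoothConnection_of_christoffel (christoffel_constConnection A)

/-! ### Symmetries of trilinear arrays -/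

lemma eps_swap_left (i j k : Fin 3) : eps j i k = -eps i j k := by
  fin_cases i <;> fin_cases j <;> fin_cases k <;> simp [eps]

lemma eps_swap_right (i j k : Fin 3) : eps i k j = -eps i j k := by
  fin_cases i <;> fin_cases j <;> fin_cases k <;> simp [eps]

/-- Polarized form of skewness in the last two indices; it passes from the frame to arbitrary
vectors, both for metricity and for skew torsion. -/
lemma sum_trilinear_add_swap {A : Fin 3 → Fin 3 → Fin 3 → ℝ} (hA : ∀ i j k, A i k j = -A i j k)
    (x y z : Fin 3 → ℝ) :
    ∑ k, (∑ i, ∑ j, A i j k * x i * y j) * z k + ∑ k, y k * ∑ i, ∑ j, A i j k * x i * z j = 0 := by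
  have h : ∑ k, (∑ i, ∑ j, A i j k * x i * y j) * z k +
      ∑ k, y k * ∑ i, ∑ j, A i j k * x i * z j =
      ∑ i, ∑ j, ∑ k, (A i j k + A i k j) * (x i * y j * z k) := by
    simp only [Fin.sum_univ_three]
    ring
  have h0 (i j k) : A i j k + A i k j = 0 := by rw [hA i j k, add_neg_cancel]
  simp only [h, h0, zero_mul, Finset.sum_const_zero]

lemma g_comm (p : S3) (u v : T p) : g p u v = g p v u := real_inner_comm _ _

/-! ### Metric connections -/

lemma mvfderiv_g {Y Z : VField} (hY : IsSmooth Y) (hZ : IsSmooth Z) (p : S3) (v : T p) :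
    mvfderiv (𝓡 3) (fun q ↦ g q (Y q) (Z q)) p v =
      ∑ k, (mvfderiv (𝓡 3) (fun q ↦ flat k q (Y q)) p v * flat k p (Z p) +
        flat k p (Y p) * mvfderiv (𝓡 3) (fun q ↦ flat k q (Z q)) p v) := by
  have hy (k) := (contMDiff_flat k hY).mdifferentiableAt (x := p) (by simp)
  have hz (k) := (contMDiff_flat k hZ).mdifferentiableAt (x := p) (by simp)
  have hyz (k) := (hy k).mul (hz k)
  have hg : (fun q ↦ g q (Y q) (Z q)) =
      (fun q ↦ flat 0 q (Y q)) * (fun q ↦ flat 0 q (Z q)) +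
      (fun q ↦ flat 1 q (Y q)) * (fun q ↦ flat 1 q (Z q)) +
      (fun q ↦ flat 2 q (Y q)) * (fun q ↦ flat 2 q (Z q)) := by
    ext q
    simp [g_eq_sum, Fin.sum_univ_three]
  rw [hg, mvfderiv_add ((hyz 0).add (hyz 1)) (hyz 2), mvfderiv_add (hyz 0) (hyz 1),
    mvfderiv_mul (hy 0) (hz 0), mvfderiv_mul (hy 1) (hz 1), mvfderiv_mul (hy 2) (hz 2)]
  simp only [add_apply, smul_apply, smul_eq_mul, Fin.sum_univ_three]
  ring

lemma isMetric_iff (nabla : Connection) :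
    IsMetric nabla ↔ ∀ p i j k, christoffel nabla p i k j = -christoffel nabla p i j k := by
  constructor
  · intro h p i j k
    -- On frame fields `g` is constant, so the left-hand side of the metric condition vanishes.
    have := h (E i) (E j) (E k) (isSmooth_E i) (isSmooth_E j) (isSmooth_E k) p
    rw [mvfderiv_g (isSmooth_E j) (isSmooth_E k)] at this
    simp only [mvfderiv_flat_E] at this
    rw [g_comm p (cov nabla (E i) (E j) p)] at this
    change _ = christoffel nabla p i j k + christoffel nabla p i k j at this
    simp at this
    linarith
  · intro h X Y Z hX hY hZ p
    rw [mvfderiv_g hY hZ, g_eq_sum, g_eq_sum]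
    simp only [flat_cov nabla X hY, flat_cov nabla X hZ, add_mul, mul_add, Finset.sum_add_distrib]
    linarith [sum_trilinear_add_swap (h p) (fun i ↦ flat i p (X p)) (fun i ↦ flat i p (Y p))
      (fun i ↦ flat i p (Z p))]

/-! ### Torsion -/

lemma flat_torsion (nabla : Connection) (p : S3) (u v : T p) (k : Fin 3) :
    flat k p (nabla.torsion p u v) = ∑ i, ∑ j,
      (christoffel nabla p i j k - christoffel nabla p j i k + 2 * eps i j k) *
        flat i p u * flat j p v := by
  have hE (i j : Fin 3) : flat k p (nabla.torsion p (E i p) (E j p)) =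
      christoffel nabla p i j k - christoffel nabla p j i k + 2 * eps i j k := by
    rw [nabla.torsion_apply (mdifferentiableAt_of_isSmooth (isSmooth_E i) p)
      (mdifferentiableAt_of_isSmooth (isSmooth_E j) p), flat_sub, flat_sub, flat_mlieBracket_E]
    change christoffel nabla p i j k - christoffel nabla p j i k - _ = _
    ring
  conv_lhs => rw [← sum_flat_smul_E p u, ← sum_flat_smul_E p v]
  simp only [map_sum, map_smul, sum_apply, smul_apply, flat_sum, flat_smul, hE, Finset.mul_sum]
  rw [Finset.sum_comm]
  refine Finset.sum_congr rfl fun i _ ↦ Finset.sum_congr rfl fun j _ ↦ ?_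
  ring

lemma torsion_eq_zero_iff_christoffel (nabla : Connection) :
    nabla.torsion = 0 ↔ ∀ p i j k,
      christoffel nabla p i j k - christoffel nabla p j i k + 2 * eps i j k = 0 := by
  constructor
  · intro h p i j k
    have := flat_torsion nabla p (E i p) (E j p) k
    rw [h] at this
    simpa [flat_E, flat_zero] using this.symm
  · intro h
    ext1 p
    ext1 u
    ext1 v
    refine ext_flat fun k ↦ ?_
    rw [flat_torsion]
    simp [h, flat_zero]

lemma hasSkewTorsion_iff (nabla : Connection) :
    HasSkewTorsion nabla ↔ ∀ p i j k,
      christoffel nabla p i k j - christoffel nabla p k i j + 2 * eps i k j =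
        -(christoffel nabla p i j k - christoffel nabla p j i k + 2 * eps i j k) := by
  have hE (p i j k) : torsionForm nabla p (E i p) (E j p) (E k p) =
      christoffel nabla p i j k - christoffel nabla p j i k + 2 * eps i j k := by
    rw [torsionForm, g_comm]
    refine (flat_torsion nabla p (E i p) (E j p) k).trans ?_
    simp [flat_E]
  constructor
  · intro h p i j k
    rw [← hE, ← hE]
    exact (h p _ _ _).2
  · intro h p u v w
    constructor
    -- Skewness in the first two arguments holds for every torsion tensor; only the last two carry a
    -- condition.
    · rw [torsionForm, torsionForm, nabla.torsion_antisymm, g, g, map_neg, inner_neg_left]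
    · rw [torsionForm, torsionForm, g_comm, g_eq_sum, g_eq_sum]
      simp only [flat_torsion]
      linarith [sum_trilinear_add_swap (h p) (fun i ↦ flat i p u) (fun i ↦ flat i p v)
        (fun i ↦ flat i p w)]

/-! ### The Levi-Civita connection -/

lemma isLeviCivita_iff (nabla : Connection) :
    IsLeviCivita nabla ↔ ∀ p i j k, christoffel nabla p i j k = -eps i j k := by
  rw [IsLeviCivita, isMetric_iff, torsion_eq_zero_iff_christoffel]
  constructor
  · rintro ⟨-, h1, h2⟩ p i j k
    -- This is the Koszul argument: three instances of metricity and three of vanishing torsion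
    -- determine `Γ i j k`.
    have a1 := h1 p i j k
    have a2 := h1 p j i k
    have a3 := h1 p k i j
    have b1 := h2 p i j k
    have b2 := h2 p j k i
    have b3 := h2 p i k j
    have e1 := eps_swap_right i j k
    have e2 := eps_swap_right j i k
    have e3 := eps_swap_left i j k
    linarith
  · intro h
    refine ⟨isSmoothConnection_of_christoffel (A := fun i j k ↦ -eps i j k)
      fun p ↦ by ext i j k; exact h p i j k, fun p i j k ↦ ?_, fun p i j k ↦ ?_⟩
    · rw [h, h, eps_swap_right]
    · rw [h, h, eps_swap_left]
      ring

/-! ### Difference tensors -/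

/-- The derivative terms of two connections agree, so their difference is a tensor and can be
compared on the frame alone. -/
lemma cov_eq_add_iff (nabla nabla0 : Connection) (S : (p : S3) → T p → T p → T p)
    (B : Fin 3 → Fin 3 → Fin 3 → ℝ) (hS : ∀ p u v k,
      flat k p (S p u v) = ∑ i, ∑ j, B i j k * flat i p u * flat j p v) :
    (∀ X Y : VField, IsSmooth X → IsSmooth Y → ∀ p,
      cov nabla X Y p = cov nabla0 X Y p + S p (X p) (Y p)) ↔
    ∀ p i j k, christoffel nabla p i j k = christoffel nabla0 p i j k + B i j k := by
  constructor
  · intro h p i j k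
    rw [christoffel, h _ _ (isSmooth_E i) (isSmooth_E j), flat_add, hS, christoffel]
    simp [flat_E]
  · intro h X Y _ hY p
    refine ext_flat fun k ↦ ?_
    rw [flat_add, flat_cov _ _ hY, flat_cov _ _ hY, hS]
    simp only [h, add_mul, Finset.sum_add_distrib]
    ring

/-! ### The tensors `sigma`, `psi`, `eta`, `xi` in the frame -/

lemma flat_sigma (j k : Fin 3) (p : S3) (v : T p) :
    flat k p (sigma j p v) = ∑ l, eps j l k * flat l p v := by
  rw [sigma, flat_sub, flat_smul, flat_smul, flat_E, flat_E, Fin.sum_univ_three]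
  fin_cases j <;> fin_cases k <;> simp [eps]

lemma isMetricFamily_iff (nabla0 nabla : Connection) (t : Fin 3 → Fin 3 → ℝ) :
    IsMetricFamily nabla0 t nabla ↔ ∀ p i j k,
      christoffel nabla p i j k = christoffel nabla0 p i j k + ∑ m, t i m * eps m j k := by
  refine cov_eq_add_iff nabla nabla0 (fun p u v ↦ ∑ i, ∑ j, (t i j * flat i p u) • sigma j p v)
    (fun i j k ↦ ∑ m, t i m * eps m j k) fun p u v k ↦ ?_
  simp only [flat_sum, flat_smul, flat_sigma]
  simp only [Fin.sum_univ_three]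
  ring

lemma inner_I_smul (x y : C2) : inner ℝ x (Complex.I • y) = -inner ℝ (Complex.I • x) y := by
  rw [inner_C2, inner_C2]
  simp
  ring

lemma inner_coe_incl (p : S3) (v : T p) : inner ℝ (p : C2) (incl p v) = 0 := by
  rw [← Submodule.mem_orthogonal_singleton_iff_inner_right, ← range_incl]
  exact ⟨v, rfl⟩

lemma flat_tangentPart (k : Fin 3) (p : S3) (w : C2) :
    flat k p (tangentPart p w) = inner ℝ (frameLin k p) w := by
  rw [flat_eq, incl_tangentPart, innerSL_apply_apply, inner_sub_right, real_inner_smul_right,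
    real_inner_comm (p : C2) (frameLin k p), inner_frameLin_self, mul_zero, sub_zero]

/-- Multiplication by `i` sends `E₁` to `E₂`, `E₂` to `-E₁` and `E₃` to the normal direction, which
the projection removes. -/
lemma flat_psi (k : Fin 3) (p : S3) (v : T p) :
    flat k p (psi p v) = ![-flat 1 p v, flat 0 p v, 0] k := by
  rw [psi, flat_tangentPart, inner_I_smul, flat_eq, flat_eq, innerSL_apply_apply,
    innerSL_apply_apply]
  have h0 : Complex.I • frameLin 0 (p : C2) = frameLin 1 p := by
    ext j; fin_cases j <;> simp [frameLin_zero_apply, frameLin_one_apply]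
  have h1 : Complex.I • frameLin 1 (p : C2) = -frameLin 0 p := by
    rw [← h0, smul_smul, Complex.I_mul_I, neg_one_smul]
  have h2 : Complex.I • frameLin 2 (p : C2) = -(p : C2) := by
    ext j; fin_cases j <;> simp [frameLin_two_apply, ← mul_assoc]
  fin_cases k <;> simp [h0, h1, h2, inner_coe_incl]

lemma frameLin_two_eq (x : C2) : frameLin 2 x = Complex.I • x := by
  ext j; fin_cases j <;> simp [frameLin_two_apply]

lemma eta_eq (p : S3) (v : T p) : eta p v = -flat 2 p v := by
  rw [eta, real_inner_comm, inner_I_smul, flat_eq, frameLin_two_eq]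
  rfl

lemma flat_xi (k : Fin 3) (p : S3) : flat k p (xi p) = if k = 2 then -1 else 0 := by
  have h := flat_E k 2 p
  rw [flat_eq, incl_E, innerSL_apply_apply, frameLin_two_eq] at h
  rw [xi, flat_tangentPart, inner_neg_right, h]
  split_ifs <;> simp

/-- Since `ξ = -E₃`, `η = -E₃^♭` and `ψ` is the quarter turn of the plane of `E₁, E₂`, the tensor is
the cross product of the oriented frame. -/
lemma isSkewFamily_iff (nabla0 nabla : Connection) (r : ℝ) :
    IsSkewFamily nabla0 r nabla ↔ ∀ p i j k,
      christoffel nabla p i j k = christoffel nabla0 p i j k + r * eps i j k := by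
  refine cov_eq_add_iff nabla nabla0
    (fun p u v ↦ r • (Phi p u v • xi p - eta p u • psi p v + eta p v • psi p u))
    (fun i j k ↦ r * eps i j k) fun p u v k ↦ ?_
  rw [flat_smul, flat_add, flat_sub, flat_smul, flat_smul, flat_smul, Phi, g_eq_sum, eta_eq, eta_eq,
    flat_xi]
  simp only [flat_psi, Fin.sum_univ_three]
  fin_cases k <;> simp [eps] <;> ring

/-! ### The action of `SU(2)` in the frame -/

/-- The linear isometry of `ℂ²` given by an element of `SU(2)`. -/
def su2Isometry (s : SU2) : C2 →ₗᵢ[ℝ] C2 where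
  toFun x := WithLp.toLp 2 ((s : Matrix (Fin 2) (Fin 2) ℂ).mulVec x)
  map_add' x y := by ext j; simp [Matrix.mulVec_add]
  map_smul' c x := by ext j; simp [Matrix.mulVec_smul]
  norm_map' := norm_mulVec s

lemma coe_tau (s : SU2) (p : S3) : (tau s p : C2) = su2Isometry s p := rfl

lemma SU2_conj_entries (s : SU2) :
    conj ((s : Matrix (Fin 2) (Fin 2) ℂ) 0 0) = (s : Matrix (Fin 2) (Fin 2) ℂ) 1 1 ∧
      conj ((s : Matrix (Fin 2) (Fin 2) ℂ) 0 1) = -(s : Matrix (Fin 2) (Fin 2) ℂ) 1 0 := by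
  obtain ⟨h1, h2⟩ := Matrix.mem_specialUnitaryGroup_iff.1 s.2
  -- Both sides are the inverse of `s`: it is unitary of determinant one.
  have h3 : star (s : Matrix (Fin 2) (Fin 2) ℂ) = (s : Matrix (Fin 2) (Fin 2) ℂ).adjugate := by
    calc _ = star (s : Matrix (Fin 2) (Fin 2) ℂ) *
          ((s : Matrix (Fin 2) (Fin 2) ℂ) * (s : Matrix (Fin 2) (Fin 2) ℂ).adjugate) := by
            rw [Matrix.mul_adjugate, h2, one_smul, mul_one]
      _ = _ := by rw [← mul_assoc, Matrix.mem_unitaryGroup_iff'.1 h1, one_mul]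
  rw [Matrix.adjugate_fin_two] at h3
  exact ⟨by simpa using congrFun (congrFun h3 0) 0, by simpa using congrFun (congrFun h3 1) 0⟩

/-- Quaternionically, left multiplications commute with right multiplications. This is the left
invariance of the frame. -/
lemma frameLin_su2Isometry (k : Fin 3) (s : SU2) (x : C2) :
    frameLin k (su2Isometry s x) = su2Isometry s (frameLin k x) := by
  obtain ⟨h1, h2⟩ := SU2_conj_entries s
  have h3 := congrArg conj h1
  have h4 := congrArg conj h2
  rw [Complex.conj_conj] at h3
  rw [Complex.conj_conj, map_neg] at h4
  have e (x : C2) : su2Isometry s x =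
      !₂[(s : Matrix (Fin 2) (Fin 2) ℂ) 0 0 * x 0 + (s : Matrix (Fin 2) (Fin 2) ℂ) 0 1 * x 1,
        (s : Matrix (Fin 2) (Fin 2) ℂ) 1 0 * x 0 + (s : Matrix (Fin 2) (Fin 2) ℂ) 1 1 * x 1] := by
    ext j
    fin_cases j <;> simp [su2Isometry]
  rw [e, e]
  ext j
  fin_cases k <;> fin_cases j <;>
    simp [frameLin_zero_apply, frameLin_one_apply, frameLin_two_apply, ← h1, h4] <;> ring

lemma contMDiff_tau (s : SU2) : ContMDiff (𝓡 3) (𝓡 3) ∞ (tau s) :=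
  ContMDiff.codRestrict_sphere (f := fun p : S3 ↦ su2Isometry s p)
    ((su2Isometry s).contDiff.contMDiff.comp contMDiff_coe) _

lemma tau_tau_inv (s : SU2) (p : S3) : tau s (tau s⁻¹ p) = p := by
  ext1
  change WithLp.toLp 2 ((s : Matrix (Fin 2) (Fin 2) ℂ).mulVec
    (((s⁻¹ : SU2) : Matrix (Fin 2) (Fin 2) ℂ).mulVec (p : C2))) = _
  rw [Matrix.mulVec_mulVec, ← Submonoid.coe_mul, mul_inv_cancel]
  simp

lemma incl_mfderiv_tau (s : SU2) (p : S3) (v : T p) :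
    incl (tau s p) (mfderiv (𝓡 3) (𝓡 3) (tau s) p v) = su2Isometry s (incl p v) := by
  have h1 : MDifferentiableAt (𝓡 3) (𝓡 3) (tau s) p :=
    (contMDiff_tau s).mdifferentiableAt (by simp)
  have h2 (q) : MDifferentiableAt (𝓡 3) 𝓘(ℝ, C2) ((↑) : S3 → C2) q :=
    contMDiff_coe.mdifferentiableAt (by simp)
  have h3 := mfderiv_comp_apply (I := 𝓡 3) (I' := 𝓡 3) (I'' := 𝓘(ℝ, C2))
    (f := tau s) (g := ((↑) : S3 → C2)) p (h2 _) h1 v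
  have h4 := mfderiv_comp_apply (I := 𝓡 3) (I' := 𝓘(ℝ, C2)) (I'' := 𝓘(ℝ, C2))
    (f := ((↑) : S3 → C2)) (g := (su2Isometry s).toContinuousLinearMap) p
    (ContinuousLinearMap.mdifferentiableAt _) (h2 p) v
  rw [ContinuousLinearMap.mfderiv_eq] at h4
  exact h3.symm.trans h4

lemma flat_mfderiv_tau (s : SU2) (k : Fin 3) {p q : S3} (h : tau s q = p) (v : T q) :
    flat k p (mfderiv (𝓡 3) (𝓡 3) (tau s) q v : EuclideanSpace ℝ (Fin 3)) = flat k q v := by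
  subst h
  rw [flat_eq, flat_eq, innerSL_apply_apply, innerSL_apply_apply, coe_tau, frameLin_su2Isometry]
  refine (congrArg _ (incl_mfderiv_tau s q v)).trans ?_
  exact (su2Isometry s).inner_map_map _ _

lemma flat_push (s : SU2) (X : VField) (k : Fin 3) (p : S3) :
    flat k p (push s X p) = flat k (tau s⁻¹ p) (X (tau s⁻¹ p)) :=
  flat_mfderiv_tau s k (tau_tau_inv s p) _

lemma isSmooth_push (s : SU2) {X : VField} (hX : IsSmooth X) : IsSmooth (push s X) := by
  refine isSmooth_of_flat fun k ↦ ?_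
  simp only [flat_push]
  exact (contMDiff_flat k hX).comp (contMDiff_tau s⁻¹)

lemma mfderiv_tau_inv_push (s : SU2) (X : VField) (p : S3) :
    mfderiv (𝓡 3) (𝓡 3) (tau s⁻¹) p (push s X p) = X (tau s⁻¹ p) :=
  ext_flat fun k ↦ (flat_mfderiv_tau s⁻¹ k rfl _).trans (flat_push s X k p)

lemma push_E (s : SU2) (i : Fin 3) : push s (E i) = E i := by
  ext1 p
  exact ext_flat fun k ↦ by rw [flat_push, flat_E, flat_E]

/-- Pushing forward only precomposes components with `tau s⁻¹`. The result differs from the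
components of `push s (cov nabla X Y)` solely in the point where the Christoffel symbols are taken.
-/
lemma flat_cov_push (nabla : Connection) (s : SU2) (X : VField) {Y : VField} (hY : IsSmooth Y)
    (p : S3) (k : Fin 3) : flat k p (cov nabla (push s X) (push s Y) p) =
      mvfderiv (𝓡 3) (fun q ↦ flat k q (Y q)) (tau s⁻¹ p) (X (tau s⁻¹ p)) +
      ∑ i, ∑ j, christoffel nabla p i j k * flat i (tau s⁻¹ p) (X (tau s⁻¹ p)) *
        flat j (tau s⁻¹ p) (Y (tau s⁻¹ p)) := by
  rw [flat_cov _ _ (isSmooth_push s hY)]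
  simp only [flat_push]
  congr 1
  have h := mvfderiv_comp_apply (f := tau s⁻¹) (g := fun q ↦ flat k q (Y q)) p
    ((contMDiff_flat k hY).mdifferentiableAt (by simp))
    ((contMDiff_tau s⁻¹).mdifferentiableAt (by simp)) (push s X p)
  rw [mfderiv_tau_inv_push] at h
  exact h

/-- The base point `o = (0, 1)` of `S³`. -/
def basePoint : S3 := ⟨!₂[0, 1], by simp [EuclideanSpace.norm_eq]⟩

lemma tau_toSU2_basePoint (p : S3) : tau (toSU2 p) basePoint = p := by
  ext j
  fin_cases j <;> simp [tau, toSU2, basePoint]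

lemma tau_inv_toSU2 (p : S3) : tau (toSU2 p)⁻¹ p = basePoint := by
  conv_lhs => rw [← tau_toSU2_basePoint p]
  rw [tau_toSU2_basePoint]
  have h := tau_tau_inv (toSU2 p)⁻¹ basePoint
  rwa [inv_inv, tau_toSU2_basePoint] at h

/-- Transitivity carries the symbols at `basePoint` to any `p` via `toSU2 p`, the frame fields being
fixed by `push`. -/
lemma isInvariant_iff (nabla : Connection) :
    IsInvariant nabla ↔ ∀ p, christoffel nabla p = christoffel nabla basePoint := by
  constructor
  · intro h p
    ext i j k
    have := congrArg (flat k p) (congrFun (h (toSU2 p) (E i) (E j) (isSmooth_E i) (isSmooth_E j)) p)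
    rw [flat_push, tau_inv_toSU2, push_E, push_E] at this
    exact this.symm
  · intro h s X Y _ hY
    ext1 p
    refine ext_flat fun k ↦ ?_
    rw [flat_push, flat_cov _ _ hY, flat_cov_push _ _ _ hY, h p, h (tau s⁻¹ p)]

/-! ### Curvature -/

lemma sum_eps (k : Fin 3) (x y : Fin 3 → ℝ) (a : ℝ) :
    ∑ i, ∑ j, a * eps i j k * x i * y j = a * (x (k + 1) * y (k + 2) - x (k + 2) * y (k + 1)) := by
  fin_cases k <;> simp [eps, Fin.sum_univ_three] <;> ring

lemma flat_mlieBracket {X Y : VField} (hX : IsSmooth X) (hY : IsSmooth Y) (p : S3) (k : Fin 3) :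
    flat k p (mlieBracket (𝓡 3) X Y p) =
      mvfderiv (𝓡 3) (fun q ↦ flat k q (Y q)) p (X p) -
        mvfderiv (𝓡 3) (fun q ↦ flat k q (X q)) p (Y p) -
        2 * (flat (k + 1) p (X p) * flat (k + 2) p (Y p) -
          flat (k + 2) p (X p) * flat (k + 1) p (Y p)) := by
  -- For the connection with parallel frame, the known torsion components turn the definition of
  -- torsion into a formula for the bracket.
  let D : Connection := constConnection 0
  have h := congrArg (flat k p) (D.torsion_apply (mdifferentiableAt_of_isSmooth hX p)
    (mdifferentiableAt_of_isSmooth hY p))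
  change _ = flat k p (cov D X Y p - cov D Y X p - _) at h
  rw [flat_torsion, flat_sub, flat_sub, flat_cov _ _ hX, flat_cov _ _ hY,
    christoffel_constConnection] at h
  simp only [Pi.zero_apply, sub_zero, zero_add, zero_mul, Finset.sum_const_zero, add_zero] at h
  rw [sum_eps k (fun i ↦ flat i p (X p)) (fun i ↦ flat i p (Y p))] at h
  linarith

section

variable {nabla : Connection} {a : ℝ}

lemma flat_cov_of_eps (h : ∀ p i j k, christoffel nabla p i j k = a * eps i j k) (X : VField)
    {Y : VField} (hY : IsSmooth Y) (p : S3) (k : Fin 3) :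
    flat k p (cov nabla X Y p) = mvfderiv (𝓡 3) (fun q ↦ flat k q (Y q)) p (X p) +
      a * (flat (k + 1) p (X p) * flat (k + 2) p (Y p) -
        flat (k + 2) p (X p) * flat (k + 1) p (Y p)) := by
  rw [flat_cov _ _ hY]
  simp only [h]
  rw [sum_eps k (fun i ↦ flat i p (X p)) (fun i ↦ flat i p (Y p))]

lemma mvfderiv_flat_cov_of_eps (h : ∀ p i j k, christoffel nabla p i j k = a * eps i j k)
    {Y Z : VField} (hY : IsSmooth Y) (hZ : IsSmooth Z) (p : S3) (v : T p) (k : Fin 3) :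
    mvfderiv (𝓡 3) (fun q ↦ flat k q (cov nabla Y Z q)) p v =
      mvfderiv (𝓡 3) (fun q ↦ mvfderiv (𝓡 3) (fun q ↦ flat k q (Z q)) q (Y q)) p v +
      a * (mvfderiv (𝓡 3) (fun q ↦ flat (k + 1) q (Y q)) p v * flat (k + 2) p (Z p) +
        flat (k + 1) p (Y p) * mvfderiv (𝓡 3) (fun q ↦ flat (k + 2) q (Z q)) p v -
        mvfderiv (𝓡 3) (fun q ↦ flat (k + 2) q (Y q)) p v * flat (k + 1) p (Z p) -
        flat (k + 2) p (Y p) * mvfderiv (𝓡 3) (fun q ↦ flat (k + 1) q (Z q)) p v) := by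
  have hy (k) := (contMDiff_flat k hY).mdifferentiableAt (x := p) (by simp)
  have hz (k) := (contMDiff_flat k hZ).mdifferentiableAt (x := p) (by simp)
  have hyz := (contMDiff_mvfderiv_apply (contMDiff_flat k hZ) hY).mdifferentiableAt
    (x := p) (by simp)
  have h1 := (hy (k + 1)).mul (hz (k + 2))
  have h2 := (hy (k + 2)).mul (hz (k + 1))
  have ha : MDifferentiableAt (𝓡 3) 𝓘(ℝ, ℝ) (fun _ : S3 ↦ a) p := mdifferentiableAt_const
  have hf : (fun q ↦ flat k q (cov nabla Y Z q)) =
      (fun q ↦ mvfderiv (𝓡 3) (fun q ↦ flat k q (Z q)) q (Y q)) + (fun _ ↦ a) *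
      ((fun q ↦ flat (k + 1) q (Y q)) * (fun q ↦ flat (k + 2) q (Z q)) -
      (fun q ↦ flat (k + 2) q (Y q)) * (fun q ↦ flat (k + 1) q (Z q))) := by
    ext q
    exact flat_cov_of_eps h Y hZ q k
  rw [hf, mvfderiv_add hyz (ha.mul (h1.sub h2)), mvfderiv_mul ha (h1.sub h2), mvfderiv_const,
    mvfderiv_sub h1 h2, mvfderiv_mul (hy _) (hz _), mvfderiv_mul (hy _) (hz _)]
  simp only [add_apply, sub_apply, smul_apply, smul_eq_mul, smul_zero, zero_apply]
  ring

/-- Second derivatives of the components of `Z` cancel against the bracket term by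
`mvfderiv_mlieBracket`, and the first-order terms cancel too. What remains is `a²` from iterated
cross products and `2a` from the structure constants `-2 ε` of the bracket. -/
lemma flat_curvature_of_eps (hs : IsSmoothConnection nabla)
    (h : ∀ p i j k, christoffel nabla p i j k = a * eps i j k)
    {X Y Z : VField} (hX : IsSmooth X) (hY : IsSmooth Y) (hZ : IsSmooth Z) (p : S3) (k : Fin 3) :
    flat k p (curvature nabla X Y Z p) = (a ^ 2 + 2 * a) *
      (flat k p (Y p) * g p (X p) (Z p) - flat k p (X p) * g p (Y p) (Z p)) := by
  rw [curvature, Pi.sub_apply, Pi.sub_apply, flat_sub, flat_sub,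
    flat_cov_of_eps h _ (isSmooth_cov hs hY hZ), flat_cov_of_eps h _ (isSmooth_cov hs hX hZ),
    flat_cov_of_eps h (mlieBracket (𝓡 3) X Y) hZ, mvfderiv_flat_cov_of_eps h hY hZ, mvfderiv_flat_cov_of_eps h hX hZ,
    mvfderiv_mlieBracket (contMDiff_flat k hZ) hX hY]
  simp only [flat_mlieBracket hX hY, flat_cov_of_eps h _ hZ, g_eq_sum, Fin.sum_univ_three]
  fin_cases k <;> simp <;> ring

lemma ricci_of_eps (hs : IsSmoothConnection nabla)
    (h : ∀ p i j k, christoffel nabla p i j k = a * eps i j k)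
    {Y Z : VField} (hY : IsSmooth Y) (hZ : IsSmooth Z) (p : S3) :
    ricci nabla Y Z p = -2 * (a ^ 2 + 2 * a) * g p (Y p) (Z p) := by
  have hk (i : Fin 3) : g p (curvature nabla (E i) Y Z p) (E i p) = (a ^ 2 + 2 * a) *
      (flat i p (Y p) * flat i p (Z p) - g p (Y p) (Z p)) := by
    rw [g_comm]
    refine (flat_curvature_of_eps hs h (isSmooth_E i) hY hZ p i).trans ?_
    rw [flat_E, if_pos rfl, one_mul]
    rfl
  simp only [ricci, hk]
  rw [g_eq_sum]
  simp only [Fin.sum_univ_three]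
  ring

end

/-! ### The two families of connections -/

section

variable {nabla0 : Connection}

lemma isMetricFamily_iff_of_isLeviCivita (h0 : IsLeviCivita nabla0) (nabla : Connection)
    (t : Fin 3 → Fin 3 → ℝ) : IsMetricFamily nabla0 t nabla ↔ ∀ p i j k,
      christoffel nabla p i j k = -eps i j k + ∑ m, t i m * eps m j k := by
  rw [isMetricFamily_iff]
  simp only [(isLeviCivita_iff nabla0).1 h0]

lemma isSkewFamily_iff_of_isLeviCivita (h0 : IsLeviCivita nabla0) (nabla : Connection) (r : ℝ) :
    IsSkewFamily nabla0 r nabla ↔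
      ∀ p i j k, christoffel nabla p i j k = (r - 1) * eps i j k := by
  rw [isSkewFamily_iff]
  simp only [(isLeviCivita_iff nabla0).1 h0]
  refine forall₄_congr fun p i j k ↦ ?_
  rw [sub_one_mul, neg_add_eq_sub]

/-- A skew `3 × 3` matrix is the cross product with the vector `(A₂₃, A₃₁, A₁₂)`. -/
lemma exists_sum_eps {A : Fin 3 → Fin 3 → ℝ} (hA : ∀ j k, A k j = -A j k) (j k : Fin 3) :
    A j k = ∑ m, A (m + 1) (m + 2) * eps m j k := by
  have h0 := hA 0 0
  have h1 := hA 1 1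
  have h2 := hA 2 2
  have h3 := hA 0 1
  have h4 := hA 1 2
  have h5 := hA 2 0
  fin_cases j <;> fin_cases k <;> simp [eps, Fin.sum_univ_three] <;> linarith

lemma isInvariant_and_isMetric_iff (h0 : IsLeviCivita nabla0) (nabla : Connection) :
    IsInvariant nabla ∧ IsMetric nabla ↔ ∃ t, IsMetricFamily nabla0 t nabla := by
  simp only [isInvariant_iff, isMetric_iff, isMetricFamily_iff_of_isLeviCivita h0]
  constructor
  · rintro ⟨h1, h2⟩
    -- The sum `Γ + ε` is the difference from the Levi-Civita symbols `-ε`; its skew matrices in `j,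
    -- k` are encoded as vectors.
    refine ⟨fun i m ↦ christoffel nabla basePoint i (m + 1) (m + 2) + eps i (m + 1) (m + 2),
      fun p i j k ↦ ?_⟩
    have := exists_sum_eps (A := fun j k ↦ christoffel nabla basePoint i j k + eps i j k)
      (fun j k ↦ by rw [h2, eps_swap_right]; ring) j k
    rw [h1, ← this]
    ring
  · rintro ⟨t, ht⟩
    refine ⟨fun p ↦ by ext i j k; rw [ht, ht], fun p i j k ↦ ?_⟩
    simp only [ht, eps_swap_right _ j k, mul_neg, Finset.sum_neg_distrib]
    ring

lemma exists_eq_mul_eps {A : Fin 3 → Fin 3 → Fin 3 → ℝ} (h1 : ∀ i j k, A j i k = -A i j k)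
    (h2 : ∀ i j k, A i k j = -A i j k) (i j k : Fin 3) : A i j k = A 0 1 2 * eps i j k := by
  have h3 (i k) : A i i k = 0 := by linarith [h1 i i k]
  have h4 (i j) : A i j j = 0 := by linarith [h2 i j j]
  have h5 (i j) : A i j i = 0 := by linarith [h2 i i j, h3 i j]
  have e1 := h1 0 1 2
  have e2 := h2 0 1 2
  have e3 := h2 1 0 2
  have e4 := h1 0 2 1
  have e5 := h1 1 2 0
  fin_cases i <;> fin_cases j <;> fin_cases k <;> simp [eps, h3, h4, h5] <;> linarith

lemma isInvariant_and_isMetric_and_hasSkewTorsion_iff (h0 : IsLeviCivita nabla0)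
    (nabla : Connection) :
    IsInvariant nabla ∧ IsMetric nabla ∧ HasSkewTorsion nabla ↔
      ∃ r, IsSkewFamily nabla0 r nabla := by
  simp only [isInvariant_iff, isMetric_iff, hasSkewTorsion_iff,
    isSkewFamily_iff_of_isLeviCivita h0]
  constructor
  · rintro ⟨h1, h2, h3⟩
    -- The value of `r` is forced by `Γ 0 1 2 = r - 1`.
    refine ⟨christoffel nabla basePoint 0 1 2 + 1, fun p i j k ↦ ?_⟩
    rw [add_sub_cancel_right, h1]
    refine exists_eq_mul_eps (fun i j k ↦ ?_) (h2 basePoint) i j k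
    -- Skew torsion together with metricity makes `Γ` invariant under cyclic permutations; with
    -- skewness in the last two indices this gives skewness in the first two.
    have a1 := h3 basePoint i j k
    have a2 := h3 basePoint j k i
    have a3 := h3 basePoint k i j
    have b1 := h2 basePoint i j k
    have b2 := h2 basePoint j k i
    have b3 := h2 basePoint k i j
    have e1 := eps_swap_right i j k
    have e2 := eps_swap_right j k i
    have e3 := eps_swap_right k i j
    have f1 := eps_swap_left i j k
    have f2 := eps_swap_left j k i
    have f3 := eps_swap_left k i j
    linarith
  · rintro ⟨r, hr⟩
    refine ⟨fun p ↦ by ext i j k; rw [hr, hr], fun p i j k ↦ ?_, fun p i j k ↦ ?_⟩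
    · rw [hr, hr, eps_swap_right i j k]
      ring
    · rw [hr, hr, hr, hr, eps_swap_left i k j, eps_swap_left i j k, eps_swap_right i j k]
      ring

lemma symRicci_of_isSkewFamily (h0 : IsLeviCivita nabla0) {nabla : Connection}
    (hs : IsSmoothConnection nabla) {r : ℝ} (hr : IsSkewFamily nabla0 r nabla) {Y Z : VField}
    (hY : IsSmooth Y) (hZ : IsSmooth Z) (p : S3) :
    symRicci nabla Y Z p = 2 * (1 - r ^ 2) * g p (Y p) (Z p) := by
  have h := (isSkewFamily_iff_of_isLeviCivita h0 nabla r).1 hr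
  rw [symRicci, ricci_of_eps hs h hY hZ, ricci_of_eps hs h hZ hY, g_comm p (Z p)]
  ring

lemma scalarCurvature_of_isSkewFamily (h0 : IsLeviCivita nabla0) {nabla : Connection}
    (hs : IsSmoothConnection nabla) {r : ℝ} (hr : IsSkewFamily nabla0 r nabla) (p : S3) :
    scalarCurvature nabla p = 6 * (1 - r ^ 2) := by
  have h := (isSkewFamily_iff_of_isLeviCivita h0 nabla r).1 hr
  simp only [scalarCurvature, ricci_of_eps hs h (isSmooth_E _) (isSmooth_E _), g_E,
    Fin.sum_univ_three, if_true]
  ring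

end

end SphereThree

end

/-! ### The classification and the Einstein equation -/

theorem mainTheorem5 :
    (∃ nablaG : SphereThree.Connection, SphereThree.IsLeviCivita nablaG) ∧
    ∀ nablaG : SphereThree.Connection, SphereThree.IsLeviCivita nablaG →
      (∀ t : Fin 3 → Fin 3 → ℝ, ∃ nabla : SphereThree.Connection,
        SphereThree.IsSmoothConnection nabla ∧ SphereThree.IsMetricFamily nablaG t nabla) ∧
      (∀ r : ℝ, ∃ nabla : SphereThree.Connection,
        SphereThree.IsSmoothConnection nabla ∧ SphereThree.IsSkewFamily nablaG r nabla) ∧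
      ∀ nabla : SphereThree.Connection, SphereThree.IsSmoothConnection nabla →
        (SphereThree.IsInvariant nabla ∧ SphereThree.IsMetric nabla ↔
          ∃ t : Fin 3 → Fin 3 → ℝ, SphereThree.IsMetricFamily nablaG t nabla) ∧
        (SphereThree.IsInvariant nabla ∧ SphereThree.IsMetric nabla ∧
            SphereThree.HasSkewTorsion nabla ↔
          ∃ r : ℝ, SphereThree.IsSkewFamily nablaG r nabla) ∧
        ∀ r : ℝ, SphereThree.IsSkewFamily nablaG r nabla →
          SphereThree.IsNablaEinstein nabla ∧
          ∀ Y Z : SphereThree.VField, SphereThree.IsSmooth Y → SphereThree.IsSmooth Z →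
            ∀ p : SphereThree.S3, SphereThree.symRicci nabla Y Z p =
              2 * (1 - r ^ 2) * SphereThree.g p (Y p) (Z p) := by
  open SphereThree in
  refine ⟨⟨constConnection fun i j k ↦ -eps i j k, (isLeviCivita_iff _).2 fun p i j k ↦ by
    rw [christoffel_constConnection]⟩, fun nablaG hG ↦ ⟨fun t ↦ ?_, fun r ↦ ?_, fun nabla hs ↦
    ⟨isInvariant_and_isMetric_iff hG nabla,
      isInvariant_and_isMetric_and_hasSkewTorsion_iff hG nabla, fun r hr ↦ ⟨?_, ?_⟩⟩⟩⟩
  · exact ⟨_, smooth_constConnection fun i j k ↦ -eps i j k + ∑ m, t i m * eps m j k,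
      (isMetricFamily_iff_of_isLeviCivita hG _ t).2 fun p i j k ↦ by
        rw [christoffel_constConnection]⟩
  · exact ⟨_, smooth_constConnection fun i j k ↦ (r - 1) * eps i j k,
      (isSkewFamily_iff_of_isLeviCivita hG _ r).2 fun p i j k ↦ by
        rw [christoffel_constConnection]⟩
  · obtain ⟨-, hm, ht⟩ := (isInvariant_and_isMetric_and_hasSkewTorsion_iff hG nabla).2 ⟨r, hr⟩
    refine ⟨hm, ht, fun Y Z hY hZ p ↦ ?_⟩
    rw [symRicci_of_isSkewFamily hG hs hr hY hZ, scalarCurvature_of_isSkewFamily hG hs hr]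
    ring
  · exact fun Y Z hY hZ p ↦ symRicci_of_isSkewFamily hG hs hr hY hZ p
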